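/- **Setting.** There are $m$ identical parallel machines and $n$ jobs. Job $j$ has a random processing time $P_j\ge 0$ with finite expectation; the $P_j$ are independent and at least one of them has positive expectation. Let $\delta\ge 0$ and $\alpha>32$. Put $$T=2\max\Big\{\tfrac1m\sum_j \mathbb E[P_j],\ \max_j \mathbb E[P_j]\Big\},\qquad \tau_k=k(\delta+\alpha T)\ (k\ge 0),\qquad k^*=\Big\lfloor \log_2\big(\tfrac23\log_2 m+1\big)\Big\rfloor+2 .$$ The *LEPT assignment* of a set $R$ of jobs to a set $A$ of machines goes through the jobs of $R$ in order of non-increasing expected processing time and appends each of them to the queue of a machine of $A$ whose current total expected load is smallest (ties are broken by smallest index). The LEPT-based $\delta$-delay policy runs as follows. Let $\mathcal J_0$ be the set of all jobs and $\mathcal M_0$ the set of all machines. For $k=0,1,2,\dots$ the jobs of $\mathcal J_k$ are assigned to the machines of $\mathcal M_k$ by the LEPT assignment, and from time $\tau_k$ on each machine of $\mathcal M_k$ processes its queue in order and without idle time. At time $\tau_{k+1}-\delta=\tau_k+\alpha T$ all jobs of $\mathcal J_k$ that have not been started strictly before this time are withdrawn; they form $\mathcal J_{k+1}$ and, because of the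 delay $\delta$, can be started again from time $\tau_{k+1}$ on. $\mathcal M_{k+1}$ is the set of the machines of $\mathcal M_k$ that have completed all jobs assigned to them by time $\tau_{k+1}-\delta$ (the machines available at each of the times $\tau_1,\dots,\tau_{k+1}$). Let $$\Xi_k=\frac1{Tm}\sum_{j\in\mathcal J_k}\mathbb E[P_j],\qquad A_k=\frac{|\mathcal M_k|}{m}$$ be the normalised expected load of the jobs not started before $\tau_k$ and the fraction of machines that are available at each of the times $\tau_1,\dots,\tau_k$. Only $k\le k^*$ is considered below. Let $\gamma_1=1$ and $\gamma_{k+1}=\gamma_k^2/2$ for $k\ge1$, and let $$\beta_k=\frac34-\frac2\alpha\sum_{h=1}^{k-2}\gamma_h,\qquad \psi=\frac1{8k^*+16},\qquad \varepsilon=\exp\Big(-\frac{(\alpha-32)^2m^{1/3}}{768}\Big),$$ where an empty sum is $0$. **Statement.** For every $\alpha>32$ there is an $m_0$, depending only on $\alpha$, such that the following holds for every $m\ge m_0$, every such instance with $m$ machines, every $\delta\ge0$ and every $k$ with $1\le k<k^*$. If $$\mathbb P(\Xi_k\le\gamma_k)\ \ge\ 1-(2^k-1)\varepsilon\qquad\text{and}\qquad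 \mathbb P\big(A_k\ge\beta_k-(k-2)\psi\big)\ \ge\ 1-(2^k-1)\varepsilon,$$ then $$\mathbb P(\Xi_{k+1}\le\gamma_{k+1})\ \ge\ 1-(2^{k+1}-1)\varepsilon\qquad\text{and}\qquad \mathbb P\big(A_{k+1}\ge\beta_{k+1}-(k-1)\psi\big)\ \ge\ 1-(2^{k+1}-1)\varepsilon .$$ -/

import Mathlib

noncomputable section

namespace LEPTDelay

/-! ### The fixed assignment policy induced by the LEPT rule -/

/-- The jobs of `R` in order of non-increasing expected processing time `e`
(ties: smaller job index first). -/
def leptOrder {n : ℕ} (e : Fin n → ℝ) (R : Finset (Fin n)) : List (Fin n) :=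
  (R.sort (· ≤ ·)).insertionSort (fun a b => e b ≤ e a)

/-- Append job `j` to the queue of a machine of `A` whose current expected load is minimal
(ties: smaller machine index first). If `A` is empty, nothing is assigned. -/
def leptStep {n m : ℕ} (e : Fin n → ℝ) (A : Finset (Fin m))
    (q : Fin m → List (Fin n)) (j : Fin n) : Fin m → List (Fin n) :=
  match (A.sort (· ≤ ·)).argmin (fun i => ((q i).map e).sum) with
  | none => q
  | some i => Function.update q i (q i ++ [j])

/-- The LEPT assignment of the jobs in `R` to the machines in `A`: each machine gets a queue of
jobs, listed in the order in which they were assigned. -/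
def leptQueues {n m : ℕ} (e : Fin n → ℝ) (R : Finset (Fin n)) (A : Finset (Fin m)) :
    Fin m → List (Fin n) :=
  (leptOrder e R).foldl (leptStep e A) (fun _ => [])

/-! ### Processing a queue -/

/-- A machine processes its queue in order and without idle time, beginning at time `s`, where
`p j` is the realised processing time of job `j`. These are the jobs that it starts strictly
before time `d`. -/
def startedBefore {n : ℕ} (p : Fin n → ℝ) (d : ℝ) : List (Fin n) → ℝ → List (Fin n)
  | [], _ => []
  | j :: l, s => if s < d then j :: startedBefore p d l (s + p j) else []

/-! ### The LEPT-based delay policy -/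

/-- `T = 2 max {(1/m) ∑ⱼ E[Pⱼ], maxⱼ E[Pⱼ]}`. -/
def bigT {n : ℕ} (m : ℕ) (e : Fin n → ℝ) : ℝ :=
  2 * max ((1 / (m : ℝ)) * ∑ j, e j) (⨆ j, e j)

/-- `τ_k = k (δ + α T)`. -/
def tau {n : ℕ} (m : ℕ) (e : Fin n → ℝ) (δ α : ℝ) (k : ℕ) : ℝ :=
  k * (δ + α * bigT m e)

/-- The policy on the realisation `p` of the processing times. The state at `τ_k` consists of the
set of jobs that have not been started before `τ_k` and the set of machines that were available at
each of the times `τ_1, …, τ_k`.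

From time `τ_k` on, the machines in the second set process the jobs in the first set, as assigned
to them by the LEPT rule. At time `τ_{k+1} - δ` the policy reassigns all jobs not started so far;
because of the delay `δ` they can start at `τ_{k+1}`. They are reassigned to those machines which,
by then, have processed all the jobs assigned to them (the available ones). -/
def state {n : ℕ} (m : ℕ) (e : Fin n → ℝ) (δ α : ℝ) (p : Fin n → ℝ) :
    ℕ → Finset (Fin n) × Finset (Fin m)
  | 0 => (Finset.univ, Finset.univ)
  | k + 1 =>
    let R := (state m e δ α p k).1
    let A := (state m e δ α p k).2
    let q := leptQueues e R A
    let s := tau m e δ α k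
    let d := tau m e δ α (k + 1) - δ
    (R.filter (fun j => ∀ i ∈ A, j ∉ startedBefore p d (q i) s),
      A.filter (fun i => startedBefore p d (q i) s = q i ∧ s + ((q i).map p).sum ≤ d))

/-- `Ξ_k`: the total expected processing time of the jobs not started before `τ_k`, divided
by `T m`. -/
def remLoad {n : ℕ} (m : ℕ) (e : Fin n → ℝ) (δ α : ℝ) (p : Fin n → ℝ) (k : ℕ) : ℝ :=
  (∑ j ∈ (state m e δ α p k).1, e j) / (bigT m e * m)

/-- `A_k`: the fraction of the machines that are available at each of the times
`τ_1, …, τ_k`. -/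
def availFrac {n : ℕ} (m : ℕ) (e : Fin n → ℝ) (δ α : ℝ) (p : Fin n → ℝ) (k : ℕ) : ℝ :=
  ((state m e δ α p k).2.card : ℝ) / m

/-! ### The constants -/

/-- `k* = ⌊log₂((2/3) log₂ m + 1)⌋ + 2`. -/
def kStar (m : ℕ) : ℕ :=
  ⌊Real.logb 2 (2 / 3 * Real.logb 2 m + 1)⌋₊ + 2

/-- `γ_1 = 1` and `γ_{k+1} = γ_k² / 2` for `k ≥ 1` (the value at `0` is not used). -/
def gam : ℕ → ℝ
  | 0 => 1
  | 1 => 1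
  | k + 2 => gam (k + 1) ^ 2 / 2

/-- `β_k = 3/4 - (2/α) ∑_{1 ≤ h ≤ k-2} γ_h`. -/
def bet (α : ℝ) (k : ℕ) : ℝ :=
  3 / 4 - 2 / α * ∑ h ∈ Finset.Icc 1 (k - 2), gam h

/-- `ψ = 1 / (8 k* + 16)`. -/
def psi (m : ℕ) : ℝ := 1 / (8 * kStar m + 16)

/-- `ε = exp(-(α - 32)² m^{1/3} / 768)`. -/
def eps (α : ℝ) (m : ℕ) : ℝ :=
  Real.exp (-((α - 32) ^ 2 * (m : ℝ) ^ (1 / 3 : ℝ) / 768))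

end LEPTDelay

end

section

open MeasureTheory ProbabilityTheory

namespace LEPTDelay

/-! ### The LEPT rule -/

/-! Both conclusions follow from one event of probability at least `1 - eps α m`, on which Ξ_k ≤ γ_k
and A_k ≥ 3/4 hold for all k ≤ k* simultaneously (`exists_forall_le_measureReal`).

Call a machine late in stage k if its queue needs time at least αT, and let v be the number of late
machines divided by m. Two deterministic facts drive the recursion. Only late machines are lost, so
A_k ≤ A_{k+1} + v. Withdrawn jobs sit on late machines with at least two jobs, and LEPT gives such a
machine at most twice the average load, so Ξ_{k+1} A_k ≤ 2 Ξ_k v (`sum_state_succ_mul_card_le`).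

The state at τ_k depends only on jobs already started, hence is independent of the remaining
processing times. Given the state, queue lengths are independent sums, and Markov plus Chernoff give
v < max(4Ξ_k/α, ζ) except with probability exp(-mζ/2) (`measureReal_exists_numLate_ge_le`). With u =
m^{1/3} and ζ of order u⁻², a union bound over the k* stages costs at most ε.

Off the bad event, α > 32 turns this into Ξ_{k+1} ≤ max(Ξ_k²/2, 4ζΞ_k) with A_k ≥ 3/4
(`avail_ge_and_load_le`). Since Ξ_0 ≤ 1/2 = γ_2, the load runs two indices ahead of γ; this lead
covers the final stages, where γ may fall below the scale ζ (`load_le_gam`). -/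

theorem exists_leptStep_eq {n m : ℕ} (e : Fin n → ℝ) {A : Finset (Fin m)} (hA : A.Nonempty)
    (q : Fin m → List (Fin n)) (j : Fin n) :
    ∃ i ∈ A, (∀ i' ∈ A, ((q i).map e).sum ≤ ((q i').map e).sum) ∧
      leptStep e A q j = Function.update q i (q i ++ [j]) := by
  cases h : (A.sort (· ≤ ·)).argmin (fun i => ((q i).map e).sum) with
  | none =>
    rw [List.argmin_eq_none] at h
    obtain ⟨i, hi⟩ := hA
    have : i ∈ A.sort (· ≤ ·) := (Finset.mem_sort _).2 hi
    simp [h] at this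
  | some i =>
    refine ⟨i, (Finset.mem_sort _).1 (List.argmin_mem h), fun i' hi' => ?_, by simp [leptStep, h]⟩
    exact List.le_of_mem_argmin (f := fun i => ((q i).map e).sum) ((Finset.mem_sort _).2 hi') h

/-- The total load of the queues whose union is the multiset of the list `l`. -/
theorem sum_load_eq {n m : ℕ} (e : Fin n → ℝ) {A : Finset (Fin m)} {q : Fin m → List (Fin n)}
    {l : List (Fin n)} (h : ∑ i ∈ A, (q i : Multiset (Fin n)) = l) :
    ∑ i ∈ A, ((q i).map e).sum = (l.map e).sum := by
  have := congrArg (fun s : Multiset (Fin n) => (s.map e).sum) h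
  rw [← Multiset.coe_mapAddMonoidHom, map_sum, ← Multiset.coe_sumAddMonoidHom, map_sum] at this
  simpa using this

/-- Induction on the last job j. The receiving machine has minimal, hence at most average, load. If
it already holds a job, that job is at least as large as j by the LEPT order, so appending j at most
doubles the load. -/
theorem foldl_leptStep {n m : ℕ} (e : Fin n → ℝ) (he : ∀ j, 0 ≤ e j) {A : Finset (Fin m)}
    (hA : A.Nonempty) (l : List (Fin n)) (hl : l.Pairwise (fun a b => e b ≤ e a)) :
    ∑ i ∈ A, (l.foldl (leptStep e A) (fun _ => []) i : Multiset (Fin n)) = l ∧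
    ∀ i ∈ A, 2 ≤ (l.foldl (leptStep e A) (fun _ => []) i).length →
      ((l.foldl (leptStep e A) (fun _ => []) i).map e).sum * A.card ≤ 2 * (l.map e).sum := by
  induction l using List.reverseRecOn with
  | nil => simp
  | append_singleton l j ih =>
    rw [List.pairwise_append] at hl
    obtain ⟨ih1, ih2⟩ := ih hl.1
    rw [List.foldl_concat]
    set q := l.foldl (leptStep e A) (fun _ => []) with hq
    obtain ⟨i, hi, hmin, hstep⟩ := exists_leptStep_eq e hA q j
    rw [hstep]
    constructor
    · rw [← Finset.add_sum_erase _ _ hi]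
      have : ∑ x ∈ A.erase i, ((Function.update q i (q i ++ [j]) x : List (Fin n)) :
          Multiset (Fin n)) = ∑ x ∈ A.erase i, (q x : Multiset (Fin n)) :=
        Finset.sum_congr rfl fun x hx => by
          rw [Function.update_of_ne (Finset.ne_of_mem_erase hx)]
      rw [this, Function.update_self, ← Multiset.coe_add, add_right_comm,
        Finset.add_sum_erase A (fun x => (q x : Multiset (Fin n))) hi, ih1, Multiset.coe_add]
    · intro i' hi' hlen
      have hsum : ((l ++ [j]).map e).sum = (l.map e).sum + e j := by simp
      rw [hsum]
      by_cases hii : i' = i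
      · subst hii
        rw [Function.update_self] at hlen ⊢
        have hne : q i' ≠ [] := by
          rintro h
          simp [h] at hlen
        obtain ⟨a, ha⟩ := List.exists_mem_of_ne_nil _ hne
        have hal : a ∈ l := by
          have : a ∈ ∑ i ∈ A, (q i : Multiset (Fin n)) := Multiset.mem_sum.2 ⟨i', hi', ha⟩
          rwa [ih1] at this
        have hja : e j ≤ e a := hl.2.2 a hal j (by simp)
        have hale : e a ≤ ((q i').map e).sum := by
          refine List.single_le_sum ?_ _ (List.mem_map_of_mem ha)
          intro x hx
          obtain ⟨b, -, rfl⟩ := List.mem_map.1 hx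
          exact he b
        have havg : ((q i').map e).sum * A.card ≤ (l.map e).sum := by
          rw [← sum_load_eq e ih1, mul_comm, ← nsmul_eq_mul]
          exact Finset.card_nsmul_le_sum _ _ _ hmin
        have : ((q i' ++ [j]).map e).sum = ((q i').map e).sum + e j := by simp
        rw [this]
        have hc : (0 : ℝ) ≤ A.card := by positivity
        nlinarith [he j, mul_le_mul_of_nonneg_right (hja.trans hale) hc]
      · rw [Function.update_of_ne hii] at hlen ⊢
        linarith [ih2 i' hi' hlen, he j]

theorem leptOrder_perm {n : ℕ} (e : Fin n → ℝ) (R : Finset (Fin n)) :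
    ((leptOrder e R : List (Fin n)) : Multiset (Fin n)) = R.val := by
  rw [leptOrder, Multiset.coe_eq_coe.2 (List.perm_insertionSort _ _), Finset.sort_eq]

theorem leptOrder_pairwise {n : ℕ} (e : Fin n → ℝ) (R : Finset (Fin n)) :
    (leptOrder e R).Pairwise (fun a b => e b ≤ e a) := by
  have : Std.Total (fun a b => e b ≤ e a) := ⟨fun a b => le_total _ _⟩
  have : IsTrans (Fin n) (fun a b => e b ≤ e a) := ⟨fun a b c h1 h2 => h2.trans h1⟩
  exact List.pairwise_insertionSort _ _

theorem sum_leptOrder {n : ℕ} (e : Fin n → ℝ) (R : Finset (Fin n)) :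
    ((leptOrder e R).map e).sum = ∑ j ∈ R, e j := by
  rw [← Multiset.sum_coe, ← Multiset.map_coe, leptOrder_perm]
  rfl

theorem sum_coe_leptQueues {n m : ℕ} {e : Fin n → ℝ} (he : ∀ j, 0 ≤ e j) (R : Finset (Fin n))
    {A : Finset (Fin m)} (hA : A.Nonempty) :
    ∑ i ∈ A, (leptQueues e R A i : Multiset (Fin n)) = R.val := by
  rw [← leptOrder_perm e R]
  exact (foldl_leptStep e he hA _ (leptOrder_pairwise e R)).1

theorem sum_load_leptQueues {n m : ℕ} {e : Fin n → ℝ} (he : ∀ j, 0 ≤ e j) (R : Finset (Fin n))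
    {A : Finset (Fin m)} (hA : A.Nonempty) :
    ∑ i ∈ A, ((leptQueues e R A i).map e).sum = ∑ j ∈ R, e j := by
  rw [← sum_leptOrder e R]
  exact sum_load_eq e (foldl_leptStep e he hA _ (leptOrder_pairwise e R)).1

theorem load_leptQueues_le {n m : ℕ} {e : Fin n → ℝ} (he : ∀ j, 0 ≤ e j) (R : Finset (Fin n))
    {A : Finset (Fin m)} {i : Fin m} (hi : i ∈ A) (hlen : 2 ≤ (leptQueues e R A i).length) :
    ((leptQueues e R A i).map e).sum * A.card ≤ 2 * ∑ j ∈ R, e j := by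
  rw [← sum_leptOrder e R]
  exact (foldl_leptStep e he ⟨i, hi⟩ _ (leptOrder_pairwise e R)).2 i hi hlen

theorem mem_leptQueues_iff {n m : ℕ} {e : Fin n → ℝ} (he : ∀ j, 0 ≤ e j) (R : Finset (Fin n))
    {A : Finset (Fin m)} (hA : A.Nonempty) (j : Fin n) :
    j ∈ R ↔ ∃ i ∈ A, j ∈ leptQueues e R A i := by
  rw [← Finset.mem_val, ← sum_coe_leptQueues he R hA, Multiset.mem_sum]
  simp

theorem nodup_leptQueues {n m : ℕ} {e : Fin n → ℝ} (he : ∀ j, 0 ≤ e j) (R : Finset (Fin n))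
    {A : Finset (Fin m)} {i : Fin m} (hi : i ∈ A) : (leptQueues e R A i).Nodup := by
  rw [← Multiset.coe_nodup]
  refine Multiset.nodup_of_le ?_ R.nodup
  rw [← sum_coe_leptQueues he R ⟨i, hi⟩]
  exact Finset.single_le_sum (f := fun i => (leptQueues e R A i : Multiset (Fin n)))
    (fun _ _ => bot_le) hi

theorem disjoint_leptQueues {n m : ℕ} {e : Fin n → ℝ} (he : ∀ j, 0 ≤ e j) (R : Finset (Fin n))
    {A : Finset (Fin m)} {i i' : Fin m} (hi : i ∈ A) (hi' : i' ∈ A) (hne : i ≠ i') {j : Fin n}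
    (hj : j ∈ leptQueues e R A i) : j ∉ leptQueues e R A i' := by
  intro hj'
  have h := sum_coe_leptQueues he R ⟨i, hi⟩
  rw [← Finset.add_sum_erase _ _ hi] at h
  have hnd := R.nodup
  rw [← h, Multiset.nodup_add] at hnd
  refine Multiset.disjoint_left.1 hnd.2.2 (Multiset.mem_coe.2 hj) ?_
  exact Multiset.mem_sum.2 ⟨i', Finset.mem_erase.2 ⟨hne.symm, hi'⟩, hj'⟩

/-! ### Processing a queue -/

theorem startedBefore_eq_self {n : ℕ} {p : Fin n → ℝ} (hp : ∀ j, 0 ≤ p j) {d : ℝ} :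
    ∀ (l : List (Fin n)) (s : ℝ), s + (l.map p).sum < d → startedBefore p d l s = l
  | [], _, _ => rfl
  | j :: l, s, h => by
    rw [List.map_cons, List.sum_cons] at h
    have hl : 0 ≤ (l.map p).sum := List.sum_nonneg fun x hx => by
      obtain ⟨b, -, rfl⟩ := List.mem_map.1 hx
      exact hp b
    rw [startedBefore, if_pos (by linarith [hp j]),
      startedBefore_eq_self hp l (s + p j) (by linarith)]

/-- Whether a job is started is decided by the durations of the jobs before it in the queue, and
these were all started. -/
theorem startedBefore_congr {n : ℕ} {p p' : Fin n → ℝ} {d : ℝ} :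
    ∀ (l : List (Fin n)) (s : ℝ), (∀ j ∈ startedBefore p d l s, p j = p' j) →
      startedBefore p' d l s = startedBefore p d l s
  | [], _, _ => rfl
  | j :: l, s, h => by
    rw [startedBefore] at h
    rw [startedBefore, startedBefore]
    split_ifs with hs
    · rw [if_pos hs] at h
      rw [← h j (by simp), startedBefore_congr l (s + p j) fun x hx => h x (by simp [hx])]
    · rfl

/-- The starting time is a measurable function of `p` rather than a constant because the recursion
adds `p j` to it. -/
theorem measurableSet_startedBefore_eq {n : ℕ} (d : ℝ) :
    ∀ (l l' : List (Fin n)) (s : (Fin n → ℝ) → ℝ), Measurable s →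
      MeasurableSet {p : Fin n → ℝ | startedBefore p d l (s p) = l'}
  | [], l', s, _ => by
    simp [startedBefore]
  | j :: l, l', s, hs => by
    have hlt : MeasurableSet {p : Fin n → ℝ | s p < d} := measurableSet_lt hs measurable_const
    cases l' with
    | nil =>
      have : {p : Fin n → ℝ | startedBefore p d (j :: l) (s p) = []} = {p | s p < d}ᶜ := by
        ext p
        simp [startedBefore]
      rw [this]
      exact hlt.compl
    | cons j' l' =>
      by_cases hj : j = j'
      · have : {p : Fin n → ℝ | startedBefore p d (j :: l) (s p) = j' :: l'} =
            {p | s p < d} ∩ {p | startedBefore p d l (s p + p j) = l'} := by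
          ext p
          by_cases h : s p < d <;> simp [startedBefore, h, hj]
        rw [this]
        exact hlt.inter (measurableSet_startedBefore_eq d l l' (fun p => s p + p j)
          (hs.add (measurable_pi_apply j)))
      · have : {p : Fin n → ℝ | startedBefore p d (j :: l) (s p) = j' :: l'} = ∅ := by
          ext p
          by_cases h : s p < d <;> simp [startedBefore, h, hj]
        rw [this]
        exact MeasurableSet.empty

theorem measurableSet_mem_startedBefore {n : ℕ} (d : ℝ) (l : List (Fin n)) (s : ℝ) (j : Fin n) :
    MeasurableSet {p : Fin n → ℝ | j ∈ startedBefore p d l s} := by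
  have : {p : Fin n → ℝ | j ∈ startedBefore p d l s} =
      ⋃ l' : {l' : List (Fin n) // j ∈ l'}, {p | startedBefore p d l s = l'} := by
    ext p
    simp
  rw [this]
  exact MeasurableSet.iUnion fun l' =>
    measurableSet_startedBefore_eq d l l' (fun _ => s) measurable_const

/-! ### The state of the policy -/

theorem measurable_list_sum {n : ℕ} (l : List (Fin n)) :
    Measurable fun p : Fin n → ℝ => (l.map p).sum := by
  induction l with
  | nil => simp
  | cons j l ih =>
    simp only [List.map_cons, List.sum_cons]
    exact (measurable_pi_apply j).add ih

theorem measurableSet_filter_eq {ι Ω : Type*} [MeasurableSpace Ω] (S S' : Finset ι)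
    (Q : Ω → ι → Prop) [∀ ω, DecidablePred (Q ω)]
    (hQ : ∀ i, MeasurableSet {ω | Q ω i}) : MeasurableSet {ω | S.filter (Q ω) = S'} := by
  classical
  -- Outside `S ∪ S'` the equivalence is vacuous, which keeps the intersection finite.
  have : {ω | S.filter (Q ω) = S'} =
      ⋂ i ∈ S ∪ S', {ω | (i ∈ S ∧ Q ω i) ↔ i ∈ S'} := by
    ext ω
    simp only [Set.mem_ofPred_eq, Set.mem_iInter, Finset.ext_iff, Finset.mem_filter,
      Finset.mem_union]
    exact ⟨fun h i _ => h i, fun h i => by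
      by_cases hi : i ∈ S ∨ i ∈ S'
      · exact h i hi
      · tauto⟩
  rw [this]
  refine Finset.measurableSet_biInter _ fun i _ => ?_
  exact measurableSet_setOfPred.2
    ((measurable_const.and (measurableSet_setOfPred.1 (hQ i))).iff measurable_const)

theorem measurableSet_state_eq {n m : ℕ} (e : Fin n → ℝ) (δ α : ℝ) (k : ℕ) :
    ∀ x : Finset (Fin n) × Finset (Fin m),
      MeasurableSet {p : Fin n → ℝ | state m e δ α p k = x} := by
  induction k with
  | zero =>
    intro x
    simp only [state]
    exact MeasurableSet.const _
  | succ k ih =>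
    intro x
    have : {p : Fin n → ℝ | state m e δ α p (k + 1) = x} =
        ⋃ y : Finset (Fin n) × Finset (Fin m), {p | state m e δ α p k = y} ∩
          ({p | y.1.filter (fun j => ∀ i ∈ y.2, j ∉ startedBefore p
              (tau m e δ α (k + 1) - δ) (leptQueues e y.1 y.2 i) (tau m e δ α k)) = x.1} ∩
            {p | y.2.filter (fun i => startedBefore p (tau m e δ α (k + 1) - δ)
                (leptQueues e y.1 y.2 i) (tau m e δ α k) = leptQueues e y.1 y.2 i ∧
              tau m e δ α k + ((leptQueues e y.1 y.2 i).map p).sum ≤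
                tau m e δ α (k + 1) - δ) = x.2}) := by
      ext p
      simp [state, Prod.ext_iff]
    rw [this]
    refine MeasurableSet.iUnion fun y => (ih y).inter (.inter ?_ ?_)
    · refine measurableSet_filter_eq _ _ _ fun j => ?_
      have : {p : Fin n → ℝ | ∀ i ∈ y.2, j ∉ startedBefore p
          (tau m e δ α (k + 1) - δ) (leptQueues e y.1 y.2 i) (tau m e δ α k)} =
          ⋂ i ∈ y.2, {p : Fin n → ℝ | j ∈ startedBefore p
          (tau m e δ α (k + 1) - δ) (leptQueues e y.1 y.2 i) (tau m e δ α k)}ᶜ := by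
        ext p
        simp
      rw [this]
      exact Finset.measurableSet_biInter _ fun i _ =>
        (measurableSet_mem_startedBefore _ _ _ _).compl
    · refine measurableSet_filter_eq _ _ _ fun i => MeasurableSet.inter ?_ ?_
      · exact measurableSet_startedBefore_eq _ _ _ _ measurable_const
      · exact measurableSet_le (measurable_const.add (measurable_list_sum _)) measurable_const

/-- The state at stage `k` is determined by the processing times of the jobs started so far. -/
theorem state_congr {n m : ℕ} (e : Fin n → ℝ) (δ α : ℝ) (p p' : Fin n → ℝ) (k : ℕ)
    (h : ∀ j ∉ (state m e δ α p k).1, p j = p' j) : state m e δ α p' k = state m e δ α p k := by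
  induction k with
  | zero => rfl
  | succ k ih =>
    have hk : state m e δ α p' k = state m e δ α p k :=
      ih fun j hj => h j fun hj' => hj (Finset.mem_of_mem_filter j hj')
    have hs : ∀ i ∈ (state m e δ α p k).2, ∀ j ∈ startedBefore p (tau m e δ α (k + 1) - δ)
        (leptQueues e (state m e δ α p k).1 (state m e δ α p k).2 i) (tau m e δ α k),
        p j = p' j := by
      intro i hi j hj
      refine h j fun hj' => ?_
      rw [state, Finset.mem_filter] at hj'
      exact hj'.2 i hi hj
    simp only [state, hk]
    ext x
    · simp only [Finset.mem_filter]
      refine and_congr_right fun _ => forall₂_congr fun i hi => ?_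
      rw [startedBefore_congr _ _ (hs i hi)]
    · simp only [Finset.mem_filter]
      refine and_congr_right fun hi => ?_
      rw [startedBefore_congr _ _ (hs x hi)]
      refine and_congr_right fun heq => ?_
      have := hs x hi
      rw [heq] at this
      rw [List.map_congr_left this]

/-! ### One stage of the policy -/

/-- The number of machines of `A` whose queue, in the LEPT assignment of `R` to `A`, needs at least
the time `c`. -/
noncomputable def numLate {n m : ℕ} (e : Fin n → ℝ) (c : ℝ) (R : Finset (Fin n)) (A : Finset (Fin m))
    (p : Fin n → ℝ) : ℕ :=
  (A.filter fun i => c ≤ ((leptQueues e R A i).map p).sum).card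

theorem tau_succ_sub {n : ℕ} (m : ℕ) (e : Fin n → ℝ) (δ α : ℝ) (k : ℕ) :
    tau m e δ α (k + 1) - δ = tau m e δ α k + α * bigT m e := by
  simp only [tau]
  push_cast
  ring

theorem card_le_card_state_succ_add {n m : ℕ} (e : Fin n → ℝ) (δ α : ℝ) {p : Fin n → ℝ}
    (hp : ∀ j, 0 ≤ p j) (k : ℕ) :
    (state m e δ α p k).2.card ≤ (state m e δ α p (k + 1)).2.card +
      numLate e (α * bigT m e) (state m e δ α p k).1 (state m e δ α p k).2 p := by
  refine (Finset.card_le_card fun i hi => ?_).trans (Finset.card_union_le _ _)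
  simp only [state, tau_succ_sub, Finset.mem_union, Finset.mem_filter]
  rcases le_or_gt (α * bigT m e) (((leptQueues e (state m e δ α p k).1
    (state m e δ α p k).2 i).map p).sum) with h | h
  · exact Or.inr ⟨hi, h⟩
  · exact Or.inl ⟨hi, startedBefore_eq_self hp _ _ (by linarith), by linarith⟩

/-- A withdrawn job lies in a late queue. This queue has a second job, because a lone job is started
at once when αT > 0. Summing the LEPT bound for queues with two or more jobs over the late machines
gives the claim. -/
theorem sum_state_succ_mul_card_le {n m : ℕ} {e : Fin n → ℝ} (he : ∀ j, 0 ≤ e j) (δ : ℝ) {α : ℝ}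
    (hT : 0 < α * bigT m e) {p : Fin n → ℝ} (hp : ∀ j, 0 ≤ p j) (k : ℕ)
    (hA : (state m e δ α p k).2.Nonempty) :
    (∑ j ∈ (state m e δ α p (k + 1)).1, e j) * (state m e δ α p k).2.card ≤
      2 * (∑ j ∈ (state m e δ α p k).1, e j) *
        numLate e (α * bigT m e) (state m e δ α p k).1 (state m e δ α p k).2 p := by
  set R := (state m e δ α p k).1 with hR
  set A := (state m e δ α p k).2 with hA'
  set s := tau m e δ α k with hs
  have hsucc : (state m e δ α p (k + 1)).1 =
      R.filter (fun j => ∀ i ∈ A, j ∉ startedBefore p (s + α * bigT m e) (leptQueues e R A i) s) := by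
    simp only [state, tau_succ_sub, ← hR, ← hA', ← hs]
  set U := A.filter fun i => α * bigT m e ≤ ((leptQueues e R A i).map p).sum ∧
    2 ≤ (leptQueues e R A i).length with hU
  have hsub : (state m e δ α p (k + 1)).1 ⊆ U.biUnion fun i => (leptQueues e R A i).toFinset := by
    intro j hj
    rw [hsucc, Finset.mem_filter] at hj
    obtain ⟨i, hi, hji⟩ := (mem_leptQueues_iff he R hA j).1 hj.1
    have hnot := hj.2 i hi
    rw [Finset.mem_biUnion]
    refine ⟨i, ?_, List.mem_toFinset.2 hji⟩
    rw [hU, Finset.mem_filter]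
    refine ⟨hi, ?_, ?_⟩
    · by_contra! hlt
      rw [startedBefore_eq_self hp _ _ (by linarith)] at hnot
      exact hnot hji
    · by_contra! hlen
      match hq : leptQueues e R A i with
      | [] => simp [hq] at hji
      | [a] =>
        rw [hq] at hji hnot
        rw [startedBefore, if_pos (by linarith)] at hnot
        simp_all
      | a :: b :: l => simp [hq] at hlen
  have hload : ∀ i ∈ U, (∑ j ∈ (leptQueues e R A i).toFinset, e j) * A.card ≤
      2 * ∑ j ∈ R, e j := by
    intro i hi
    rw [hU, Finset.mem_filter] at hi
    rw [List.sum_toFinset _ (nodup_leptQueues he R hi.1)]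
    exact load_leptQueues_le he R hi.1 hi.2.2
  have hW : 0 ≤ ∑ j ∈ R, e j := Finset.sum_nonneg fun j _ => he j
  have hUcard : U.card ≤ numLate e (α * bigT m e) R A p :=
    Finset.card_le_card (Finset.monotone_filter_right _ fun i _ h => h.1)
  calc (∑ j ∈ (state m e δ α p (k + 1)).1, e j) * A.card
      ≤ (∑ i ∈ U, ∑ j ∈ (leptQueues e R A i).toFinset, e j) * A.card := by
        gcongr
        refine (Finset.sum_le_sum_of_subset_of_nonneg hsub fun j _ _ => he j).trans ?_
        rw [Finset.sum_biUnion]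
        intro i hi i' hi' hne
        refine Finset.disjoint_left.2 fun j hj hj' => ?_
        exact disjoint_leptQueues he R (Finset.mem_filter.1 hi).1 (Finset.mem_filter.1 hi').1 hne
          (List.mem_toFinset.1 hj) (List.mem_toFinset.1 hj')
    _ ≤ U.card * (2 * ∑ j ∈ R, e j) := by
        rw [Finset.sum_mul, ← nsmul_eq_mul]
        exact Finset.sum_le_card_nsmul _ _ _ hload
    _ ≤ numLate e (α * bigT m e) R A p * (2 * ∑ j ∈ R, e j) := by
        gcongr
    _ = _ := by ring

/-! ### Independence of events that depend on disjoint sets of coordinates -/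

/-- An event depending only on coordinates in `T` factors through restriction to `T`; extending by
zero recovers it as a measurable event on that finite product. -/
theorem measure_inter_preimage_of_dependsOn {Ω ι : Type*} [MeasurableSpace Ω]
    {μ : Measure Ω} {P : ι → Ω → ℝ} (hP : ∀ j, Measurable (P j)) (hind : iIndepFun P μ)
    {T T' : Finset ι} (hT : Disjoint T T') {E E' : Set (ι → ℝ)} (hE : MeasurableSet E)
    (hE' : MeasurableSet E') (hdep : ∀ p p' : ι → ℝ, (∀ j ∈ T, p j = p' j) → p ∈ E → p' ∈ E)
    (hdep' : ∀ p p' : ι → ℝ, (∀ j ∈ T', p j = p' j) → p ∈ E' → p' ∈ E') :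
    μ ((fun ω j => P j ω) ⁻¹' E ∩ (fun ω j => P j ω) ⁻¹' E') =
      μ ((fun ω j => P j ω) ⁻¹' E) * μ ((fun ω j => P j ω) ⁻¹' E') := by
  classical
  have hext : ∀ U : Finset ι, Measurable
      (fun (x : U → ℝ) j => if h : j ∈ U then x ⟨j, h⟩ else 0) := fun U =>
    measurable_pi_lambda _ fun j => by
      by_cases h : j ∈ U
      · simpa [h] using measurable_pi_apply _
      · simp [h]
  have hpre : ∀ (U : Finset ι) (F : Set (ι → ℝ)),
      (∀ p p' : ι → ℝ, (∀ j ∈ U, p j = p' j) → p ∈ F → p' ∈ F) →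
      (fun ω j => P j ω) ⁻¹' F = (fun ω (j : U) => P j ω) ⁻¹'
        ((fun (x : U → ℝ) j => if h : j ∈ U then x ⟨j, h⟩ else 0) ⁻¹' F) := by
    intro U F hF
    ext ω
    exact ⟨fun h => hF _ _ (fun j hj => by simp [hj]) h,
      fun h => hF _ _ (fun j hj => by simp [hj]) h⟩
  rw [hpre T E hdep, hpre T' E' hdep']
  exact (hind.indepFun_finset T T' hT hP).measure_inter_preimage_eq_mul _ _
    (hext T hE) (hext T' hE')

theorem iIndepFun_sum_of_pairwiseDisjoint {Ω ι κ : Type*} [MeasurableSpace Ω]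
    {μ : Measure Ω} {P : ι → Ω → ℝ} (hP : ∀ j, Measurable (P j)) (hind : iIndepFun P μ)
    {Q : κ → Finset ι} (hQ : Pairwise fun i i' => Disjoint (Q i) (Q i')) :
    iIndepFun (fun i ω => ∑ j ∈ Q i, P j ω) μ := by
  classical
  have := hind.isProbabilityMeasure
  rw [iIndepFun_iff_measure_inter_preimage_eq_mul]
  intro s B hB
  have hms : ∀ i ∈ s, MeasurableSet {p : ι → ℝ | ∑ j ∈ Q i, p j ∈ B i} := fun i hi =>
    (Finset.measurable_sum _ fun j _ => measurable_pi_apply j) (hB i hi)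
  induction s using Finset.induction_on with
  | empty => simp
  | insert a s ha ih =>
    have key := measure_inter_preimage_of_dependsOn (μ := μ) (T := Q a) (T' := s.biUnion Q)
      (E := {p | ∑ j ∈ Q a, p j ∈ B a}) (E' := ⋂ i ∈ s, {p | ∑ j ∈ Q i, p j ∈ B i}) hP hind
      ((Finset.disjoint_biUnion_right _ _ _).2 fun i hi => hQ fun h => ha (h ▸ hi))
      (hms a (Finset.mem_insert_self a s))
      (Finset.measurableSet_biInter _ fun i hi => hms i (Finset.mem_insert_of_mem hi))
      (fun p p' h hp => by simpa [Finset.sum_congr rfl h] using hp)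
      (fun p p' h hp => by
        simp only [Set.mem_iInter] at hp ⊢
        intro i hi
        have := hp i hi
        rwa [Set.mem_ofPred_eq, Finset.sum_congr rfl fun j hj =>
          h j (Finset.mem_biUnion.2 ⟨i, hi, hj⟩)] at this)
    simp only [Set.preimage_iInter] at key
    rw [Finset.prod_insert ha, Finset.set_biInter_insert,
      ← ih (fun i hi => hB i (Finset.mem_insert_of_mem hi))
        (fun i hi => hms i (Finset.mem_insert_of_mem hi))]
    exact key

/-! ### A tail bound -/

/-- The Markov and Chernoff inequalities combined: a tail bound for the number of independent
nonnegative random variables that are at least `c`. -/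
theorem measureReal_card_filter_ge_le {Ω ι : Type*} [MeasurableSpace Ω] [Fintype ι]
    {μ : Measure Ω} [IsProbabilityMeasure μ] {S : ι → Ω → ℝ} (hS : ∀ i, Measurable (S i))
    (hS0 : ∀ i ω, 0 ≤ S i ω) (hint : ∀ i, Integrable (S i) μ) (hind : iIndepFun S μ)
    {c z : ℝ} (hc : 0 < c) (hz : 4 * ∑ i, ∫ ω, S i ω ∂μ ≤ z * c) :
    μ.real {ω | z ≤ ((Finset.univ.filter fun i => c ≤ S i ω).card : ℝ)} ≤ Real.exp (-z / 2) := by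
  set X : ι → Ω → ℝ := fun i ω => if c ≤ S i ω then 1 else 0 with hX
  have hg : Measurable fun x : ℝ => if c ≤ x then (1 : ℝ) else 0 :=
    Measurable.ite measurableSet_Ici measurable_const measurable_const
  have hXm : ∀ i, Measurable (X i) := fun i => hg.comp (hS i)
  have hXind : iIndepFun X μ := hind.comp _ fun _ => hg
  have hset : {ω | z ≤ ((Finset.univ.filter fun i => c ≤ S i ω).card : ℝ)} =
      {ω | z ≤ (∑ i, X i) ω} := by
    ext ω
    simp [hX, Finset.sum_apply]
  have hexp1 : Real.exp 1 - 1 ≤ 2 := by linarith [Real.exp_one_lt_three]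
  -- Here e^X = 1 + (e - 1)·1_{S ≥ c}; Markov's inequality, e - 1 ≤ 2 and 1 + t ≤ e^t then bound its
  -- mean. In the product the exponents add up to at most z/2, leaving e^{-z/2}.
  have hmgf : ∀ i, mgf (X i) μ 1 ≤ Real.exp (2 * ((∫ ω, S i ω ∂μ) / c)) := by
    intro i
    have hms : MeasurableSet {ω | c ≤ S i ω} := measurableSet_le measurable_const (hS i)
    have hfun : (fun ω => Real.exp (1 * X i ω)) =
        fun ω => 1 + {ω | c ≤ S i ω}.indicator (fun _ => Real.exp 1 - 1) ω := by
      funext ω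
      by_cases h : c ≤ S i ω <;> simp [hX, h]
    have hmarkov : μ.real {ω | c ≤ S i ω} ≤ (∫ ω, S i ω ∂μ) / c := by
      rw [le_div_iff₀ hc, mul_comm]
      exact mul_meas_ge_le_integral_of_nonneg (Filter.Eventually.of_forall (hS0 i)) (hint i) c
    have : mgf (X i) μ 1 = 1 + μ.real {ω | c ≤ S i ω} * (Real.exp 1 - 1) := by
      rw [mgf, hfun, integral_add (integrable_const _)
        ((integrable_const _).indicator hms), integral_indicator_const _ hms]
      simp
    rw [this]
    have h0 : 0 ≤ μ.real {ω | c ≤ S i ω} := measureReal_nonneg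
    refine le_trans ?_ (Real.add_one_le_exp _)
    nlinarith
  rw [hset]
  refine (measure_ge_le_exp_mul_mgf z zero_le_one ?_).trans ?_
  · refine Integrable.of_bound (C := Real.exp (Fintype.card ι)) ?_
      (Filter.Eventually.of_forall fun ω => ?_)
    · fun_prop
    · rw [Real.norm_eq_abs, abs_of_pos (Real.exp_pos _), one_mul, Real.exp_le_exp,
        Finset.sum_apply]
      refine (Finset.sum_le_card_nsmul Finset.univ _ 1 fun i _ => ?_).trans (by simp)
      simp only [hX]
      split_ifs <;> norm_num
  · rw [hXind.mgf_sum hXm]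
    calc Real.exp (-1 * z) * ∏ i, mgf (X i) μ 1
        ≤ Real.exp (-1 * z) * ∏ i, Real.exp (2 * ((∫ ω, S i ω ∂μ) / c)) := by
          gcongr with i
          · exact fun i _ => mgf_nonneg
          · exact hmgf i
      _ = Real.exp (-1 * z + 2 * ((∑ i, ∫ ω, S i ω ∂μ) / c)) := by
          rw [← Real.exp_sum, ← Real.exp_add, ← Finset.mul_sum, Finset.sum_div]
      _ ≤ Real.exp (-z / 2) := by
          rw [Real.exp_le_exp]
          have : (∑ i, ∫ ω, S i ω ∂μ) / c ≤ z / 4 := by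
            rw [div_le_iff₀ hc]
            linarith
          linarith

/-- For fixed `R` and `A` the queues are disjoint sets of jobs, so their total durations are
independent and the tail bound applies. -/
theorem measureReal_numLate_ge_le {Ω : Type*} [MeasurableSpace Ω] {μ : Measure Ω}
    [IsProbabilityMeasure μ] {n m : ℕ} {P : Fin n → Ω → ℝ} (hP : ∀ j, Measurable (P j))
    (hP0 : ∀ j ω, 0 ≤ P j ω) (hint : ∀ j, Integrable (P j) μ) (hind : iIndepFun P μ)
    {e : Fin n → ℝ} (he : ∀ j, e j = ∫ ω, P j ω ∂μ) (R : Finset (Fin n)) {A : Finset (Fin m)}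
    (hA : A.Nonempty) {c z : ℝ} (hc : 0 < c) (hz : 4 * ∑ j ∈ R, e j ≤ z * c) :
    μ.real {ω | z ≤ (numLate e c R A (fun j => P j ω) : ℝ)} ≤ Real.exp (-z / 2) := by
  have he0 : ∀ j, 0 ≤ e j := fun j => he j ▸ integral_nonneg (hP0 j)
  set Q : A → Finset (Fin n) := fun i => (leptQueues e R A i).toFinset with hQ
  set S : A → Ω → ℝ := fun i ω => ∑ j ∈ Q i, P j ω with hS
  have hSl : ∀ (i : A) ω, S i ω = ((leptQueues e R A i).map fun j => P j ω).sum := fun i ω =>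
    List.sum_toFinset _ (nodup_leptQueues he0 R i.2)
  have hSind : iIndepFun S μ := by
    refine iIndepFun_sum_of_pairwiseDisjoint hP hind fun i i' hne => ?_
    refine Finset.disjoint_left.2 fun j hj hj' => ?_
    exact disjoint_leptQueues he0 R i.2 i'.2 (fun h => hne (Subtype.ext h))
      (List.mem_toFinset.1 hj) (List.mem_toFinset.1 hj')
  have hSint : ∑ i, ∫ ω, S i ω ∂μ = ∑ j ∈ R, e j := by
    rw [← sum_load_leptQueues he0 R hA, ← Finset.sum_coe_sort A]
    refine Finset.sum_congr rfl fun i _ => ?_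
    rw [← List.sum_toFinset _ (nodup_leptQueues he0 R i.2)]
    simp only [hS]
    rw [integral_finsetSum _ fun j _ => hint j]
    exact Finset.sum_congr rfl fun j _ => (he j).symm
  have hmain := measureReal_card_filter_ge_le (μ := μ) (S := S) (c := c) (z := z)
    (fun i => Finset.measurable_sum _ fun j _ => hP j)
    (fun i ω => Finset.sum_nonneg fun j _ => hP0 j ω)
    (fun i => integrable_finsetSum _ fun j _ => hint j) hSind hc (by rwa [hSint])
  refine le_of_eq_of_le ?_ hmain
  congr 1
  ext ω
  have : numLate e c R A (fun j => P j ω) =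
      (Finset.univ.filter fun i : A => c ≤ S i ω).card := by
    simp only [hSl, numLate]
    rw [← Finset.card_map (Function.Embedding.subtype _)]
    congr 1
    ext i
    simp
    tauto
  simp [this]

/-! ### The probability that many machines are late -/

theorem measurable_numLate {n m : ℕ} (e : Fin n → ℝ) (c : ℝ) (R : Finset (Fin n))
    (A : Finset (Fin m)) : Measurable fun p => (numLate e c R A p : ℝ) := by
  simp only [numLate, Finset.card_filter, Nat.cast_sum]
  refine Finset.measurable_sum _ fun i _ => ?_
  simp only [Nat.cast_ite]
  exact Measurable.ite (measurableSet_le measurable_const (measurable_list_sum _))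
    measurable_const measurable_const

theorem numLate_congr {n m : ℕ} {e : Fin n → ℝ} (he : ∀ j, 0 ≤ e j) (c : ℝ) (R : Finset (Fin n))
    (A : Finset (Fin m)) {p p' : Fin n → ℝ} (h : ∀ j ∈ R, p j = p' j) :
    numLate e c R A p = numLate e c R A p' := by
  rw [numLate, numLate]
  congr 1
  refine Finset.filter_congr fun i hi => ?_
  rw [List.map_congr_left fun j hj => h j ((mem_leptQueues_iff he R ⟨i, hi⟩ j).2 ⟨i, hi, hj⟩)]

/-- Decompose by the value x of the state. The event that the state is x depends on jobs outside
`x.1`, lateness on jobs inside, so the probability factors. The first term of the maximum is what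
the tail bound requires; the second gives an estimate uniform in x. -/
theorem measureReal_exists_numLate_ge_le {Ω : Type*} [MeasurableSpace Ω] {μ : Measure Ω}
    [IsProbabilityMeasure μ] {n : ℕ} (m : ℕ) {P : Fin n → Ω → ℝ} (hP : ∀ j, Measurable (P j))
    (hP0 : ∀ j ω, 0 ≤ P j ω) (hint : ∀ j, Integrable (P j) μ) (hind : iIndepFun P μ)
    {e : Fin n → ℝ} (he : ∀ j, e j = ∫ ω, P j ω ∂μ) (δ α : ℝ) {c : ℝ} (hc : 0 < c) (w : ℝ)
    (k : ℕ) :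
    μ.real {ω | (state m e δ α (fun j => P j ω) k).2.Nonempty ∧
      max (4 * (∑ j ∈ (state m e δ α (fun j => P j ω) k).1, e j) / c) w ≤
        numLate e c (state m e δ α (fun j => P j ω) k).1 (state m e δ α (fun j => P j ω) k).2
          (fun j => P j ω)} ≤ Real.exp (-w / 2) := by
  classical
  have he0 : ∀ j, 0 ≤ e j := fun j => he j ▸ integral_nonneg (hP0 j)
  have hPm : Measurable fun ω j => P j ω := measurable_pi_lambda _ hP
  set E : Finset (Fin n) × Finset (Fin m) → Set (Fin n → ℝ) := fun x =>
    {p | state m e δ α p k = x} with hE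
  set F : Finset (Fin n) × Finset (Fin m) → Set (Fin n → ℝ) := fun x =>
    {p | max (4 * (∑ j ∈ x.1, e j) / c) w ≤ numLate e c x.1 x.2 p} with hF
  have hsub : {ω | (state m e δ α (fun j => P j ω) k).2.Nonempty ∧
      max (4 * (∑ j ∈ (state m e δ α (fun j => P j ω) k).1, e j) / c) w ≤
        numLate e c (state m e δ α (fun j => P j ω) k).1 (state m e δ α (fun j => P j ω) k).2
          (fun j => P j ω)} ⊆
      ⋃ x ∈ Finset.univ.filter (fun x : Finset (Fin n) × Finset (Fin m) => x.2.Nonempty),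
        ((fun ω j => P j ω) ⁻¹' E x ∩ (fun ω j => P j ω) ⁻¹' F x) := by
    rintro ω ⟨h1, h2⟩
    rw [Set.mem_iUnion₂]
    exact ⟨state m e δ α (fun j => P j ω) k, by simpa using h1, rfl, h2⟩
  refine (measureReal_mono hsub (measure_ne_top _ _)).trans ((measureReal_biUnion_finset_le _ _).trans ?_)
  calc ∑ x ∈ Finset.univ.filter (fun x : Finset (Fin n) × Finset (Fin m) => x.2.Nonempty),
        μ.real ((fun ω j => P j ω) ⁻¹' E x ∩ (fun ω j => P j ω) ⁻¹' F x)
      ≤ ∑ x ∈ Finset.univ.filter (fun x : Finset (Fin n) × Finset (Fin m) => x.2.Nonempty),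
        μ.real ((fun ω j => P j ω) ⁻¹' E x) * Real.exp (-w / 2) := by
        refine Finset.sum_le_sum fun x hx => ?_
        rw [Finset.mem_filter] at hx
        have hindep : μ ((fun ω j => P j ω) ⁻¹' E x ∩ (fun ω j => P j ω) ⁻¹' F x) =
            μ ((fun ω j => P j ω) ⁻¹' E x) * μ ((fun ω j => P j ω) ⁻¹' F x) := by
          refine measure_inter_preimage_of_dependsOn (T := x.1ᶜ) (T' := x.1) hP hind
            disjoint_compl_left (measurableSet_state_eq e δ α k x)
            (measurableSet_le measurable_const (measurable_numLate e c x.1 x.2)) ?_ ?_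
          · intro p p' h hp
            have hp : state m e δ α p k = x := hp
            refine (state_congr e δ α p p' k fun j hj => h j ?_).trans hp
            rwa [hp, ← Finset.mem_compl] at hj
          · intro p p' h hp
            simpa only [hF, Set.mem_ofPred_eq, numLate_congr he0 c x.1 x.2 h] using hp
        rw [measureReal_def, hindep, ENNReal.toReal_mul, ← measureReal_def, ← measureReal_def]
        refine mul_le_mul_of_nonneg_left ?_ measureReal_nonneg
        refine (measureReal_numLate_ge_le (z := max (4 * (∑ j ∈ x.1, e j) / c) w)
          hP hP0 hint hind he x.1 hx.2 hc ?_).trans ?_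
        · rw [← div_le_iff₀ hc]
          exact le_max_left _ _
        · rw [Real.exp_le_exp]
          linarith [le_max_right (4 * (∑ j ∈ x.1, e j) / c) w]
    _ ≤ ∑ x : Finset (Fin n) × Finset (Fin m),
        μ.real ((fun ω j => P j ω) ⁻¹' E x) * Real.exp (-w / 2) :=
        Finset.sum_le_sum_of_subset_of_nonneg (Finset.subset_univ _) fun _ _ _ => by positivity
    _ = Real.exp (-w / 2) := by
        have : ∑ x : Finset (Fin n) × Finset (Fin m), μ.real ((fun ω j => P j ω) ⁻¹' E x) = 1 := by
          have h := sum_measureReal_preimage_singleton (μ := μ)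
            (f := fun ω => state m e δ α (fun j => P j ω) k) Finset.univ
            fun x _ => hPm (measurableSet_state_eq e δ α k x)
          rw [Finset.coe_univ, Set.preimage_univ, probReal_univ] at h
          exact h
        rw [← Finset.sum_mul, this, one_mul]

/-! ### The recursion for the remaining load and the available machines -/

theorem gam_succ {k : ℕ} (hk : 1 ≤ k) : gam (k + 1) = gam k ^ 2 / 2 := by
  obtain ⟨k, rfl⟩ := Nat.exists_eq_add_of_le' hk
  rfl

theorem gam_succ_eq (k : ℕ) : gam (k + 1) = 2 * (1 / 2) ^ 2 ^ k := by
  induction k with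
  | zero => norm_num [gam]
  | succ k ih =>
    rw [gam, ih, pow_succ 2 k, pow_mul]
    ring

theorem gam_pos (k : ℕ) : 0 < gam k := by
  cases k with
  | zero => norm_num [gam]
  | succ k =>
    rw [gam_succ_eq]
    positivity

theorem gam_antitone : Antitone gam := by
  refine antitone_nat_of_succ_le fun k => ?_
  cases k with
  | zero => norm_num [gam]
  | succ k =>
    rw [gam_succ_eq, gam_succ_eq]
    exact mul_le_mul_of_nonneg_left (pow_le_pow_of_le_one (by norm_num) (by norm_num)
      (Nat.pow_le_pow_right (by norm_num) k.le_succ)) (by norm_num)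

/-- If few machines are late at every stage, then most machines stay available, and the remaining
load decreases quadratically until it is of the order of `ζ`, and by a factor `4 ζ` from then on. -/
theorem avail_ge_and_load_le {α ζ : ℝ} (hα : 32 < α) (hζ0 : 0 ≤ ζ) (hζ : ζ ≤ 1 / 16) {K : ℕ}
    (hK : K * ζ ≤ 1 / 12) {x a : ℕ → ℝ} (hx : ∀ h, 0 ≤ x h) (hx0 : x 0 ≤ 1 / 2) (ha0 : a 0 = 1)
    (hstep : ∀ h < K, 0 < a h → ∃ v, 0 ≤ v ∧ v ≤ max (4 * x h / α) ζ ∧ a h ≤ a (h + 1) + v ∧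
      x (h + 1) * a h ≤ 2 * x h * v) :
    (∀ h ≤ K, 3 / 4 ≤ a h) ∧ ∀ h < K, x (h + 1) ≤ max (x h ^ 2 / 2) (4 * ζ * x h) := by
  have hα0 : 0 < α := by linarith
  have hone : ∀ h < K, 1 / 2 ≤ a h →
      a h ≤ a (h + 1) + x h / 8 + ζ ∧ x (h + 1) ≤ max (x h ^ 2 / 2) (4 * ζ * x h) := by
    intro h hh hah
    obtain ⟨v, hv0, hv, h1, h2⟩ := hstep h hh (by linarith)
    -- This is where α > 32 enters.
    have hdiv : 4 * x h / α ≤ x h / 8 := by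
      rw [div_le_div_iff₀ hα0 (by norm_num)]
      nlinarith [hx h]
    have hv' : v ≤ max (x h / 8) ζ := hv.trans (max_le_max_right _ hdiv)
    have h3 : x (h + 1) ≤ 4 * x h * v := by
      nlinarith [hx (h + 1)]
    constructor
    · have := hx h
      rcases le_max_iff.1 hv' with hv' | hv' <;> linarith
    · rw [le_max_iff]
      rcases le_max_iff.1 hv' with hv' | hv'
      · left
        nlinarith [mul_le_mul_of_nonneg_left hv' (hx h)]
      · right
        nlinarith [mul_le_mul_of_nonneg_left hv' (hx h)]
  -- The term `x h / 6` is a potential: a stage costs at most `x h / 8 + ζ` in availability while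
  -- the load drops to a quarter, and 1/6 - 1/8 = (1/6)·(1/4).
  have hinv : ∀ h ≤ K, x h ≤ 1 / 2 ∧ 11 / 12 - h * ζ + x h / 6 ≤ a h := by
    intro h
    induction h with
    | zero =>
      intro _
      refine ⟨hx0, ?_⟩
      rw [ha0]
      push_cast
      linarith
    | succ h ih =>
      intro hh
      obtain ⟨ih1, ih2⟩ := ih (by omega)
      have hhK : (h : ℝ) * ζ ≤ K * ζ := by
        gcongr
        omega
      obtain ⟨h1, h2⟩ := hone h hh (by linarith [hx h])
      have h4 : x (h + 1) ≤ x h / 4 := by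
        refine h2.trans (max_le ?_ ?_) <;> nlinarith [hx h]
      refine ⟨by linarith [hx h], ?_⟩
      push_cast
      linarith
  have ha : ∀ h ≤ K, 3 / 4 ≤ a h := by
    intro h hh
    have hhK : (h : ℝ) * ζ ≤ K * ζ := by gcongr
    linarith [(hinv h hh).2, hx h]
  exact ⟨ha, fun h hh => (hone h hh (by linarith [ha h hh.le])).2⟩

/-- As long as 2η ≤ γ_{h+2}, the linear term is dominated and the bound x_h ≤ γ_{h+2} propagates. It
reaches h = L; the lead of two indices is then spent on the last three stages. -/
theorem load_le_gam {η : ℝ} (hη0 : 0 ≤ η) (hη : η ≤ 1 / 4) {L : ℕ} (h1 : 2 * η ≤ gam (L + 1))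
    (h2 : 2 * η ^ 2 ≤ gam (L + 2)) {x : ℕ → ℝ} (hx : ∀ h, 0 ≤ x h) (hx0 : x 0 ≤ 1 / 2)
    (hstep : ∀ h < L + 3, x (h + 1) ≤ max (x h ^ 2 / 2) (η * x h)) :
    ∀ h ≤ L + 3, x h ≤ gam h := by
  have hhalf : ∀ h ≤ L + 3, x h ≤ 1 / 2 := by
    intro h
    induction h with
    | zero => exact fun _ => hx0
    | succ h ih =>
      intro hh
      have := ih (by omega)
      refine (hstep h hh).trans (max_le ?_ ?_) <;> nlinarith [hx h]
  have hdecr : ∀ h < L + 3, x (h + 1) ≤ x h := by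
    intro h hh
    have := hhalf h hh.le
    refine (hstep h hh).trans (max_le ?_ ?_) <;> nlinarith [hx h]
  have hfast : ∀ h ≤ L, x h ≤ gam (h + 2) := by
    intro h
    induction h with
    | zero =>
      intro _
      simpa [gam] using hx0
    | succ h ih =>
      intro hh
      have hxg := ih (by omega)
      have hg : 2 * η ≤ gam (h + 2) := h1.trans (gam_antitone (by omega))
      rw [show h + 1 + 2 = (h + 2) + 1 by ring, gam_succ (by omega)]
      refine (hstep h (by omega)).trans (max_le ?_ ?_) <;> nlinarith [hx h]
  have hL := hfast L le_rfl
  have hL1 := hstep L (by omega)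
  have hL2 := hstep (L + 1) (by omega)
  have hd0 := hdecr L (by omega)
  have hd1 := hdecr (L + 1) (by omega)
  have hd2 := hdecr (L + 2) (by omega)
  have hg : gam (L + 3) = gam (L + 2) ^ 2 / 2 := gam_succ (by omega)
  have hgpos := gam_pos (L + 2)
  -- One linear step need not reach γ_{L+3}, but two give η²γ_{L+2} ≤ γ_{L+2}²/2 by `h2`. A
  -- quadratic step among the two suffices as well.
  have hlast : x (L + 2) ≤ gam (L + 3) := by
    rw [hg]
    rcases le_max_iff.1 hL1 with h | h
    · exact hd1.trans (h.trans (by nlinarith [hx L]))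
    · have hx1 : x (L + 1) ≤ η * gam (L + 2) := h.trans (by gcongr)
      refine hL2.trans (max_le ?_ ?_)
      · nlinarith [hx (L + 1)]
      · calc η * x (L + 1) ≤ η * (η * gam (L + 2)) := by gcongr
          _ ≤ gam (L + 2) ^ 2 / 2 := by nlinarith
  intro h hh
  rcases Nat.lt_or_ge L h with hlt | hle
  · obtain rfl | rfl | rfl : h = L + 1 ∨ h = L + 2 ∨ h = L + 3 := by omega
    · exact hd0.trans (hL.trans (gam_antitone (by omega)))
    · exact hlast.trans (gam_antitone (by omega))
    · exact hd2.trans hlast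
  · exact (hfast h hle).trans (gam_antitone (by omega))

/-! ### The number of stages -/

/-- With u = m^{1/3}, the floor in k* gives 2^{k*-2} ≤ 2 log₂ u + 1, so 2^(2^{k*-2}) ≤ 2u², which is
γ_{k*-1} ≥ u⁻². -/
theorem kStar_eventually (C : ℝ) : ∃ m₀ : ℕ, ∀ m : ℕ, m₀ ≤ m →
    1 ≤ m ∧ C ≤ (m : ℝ) ^ (1 / 3 : ℝ) ∧ (kStar m : ℝ) ≤ (m : ℝ) ^ (1 / 3 : ℝ) ∧
    ∃ L, kStar m = L + 3 ∧ 1 / ((m : ℝ) ^ (1 / 3 : ℝ)) ^ 2 ≤ gam (L + 2) := by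
  have hu : Filter.Tendsto (fun m : ℕ => (m : ℝ) ^ (1 / 3 : ℝ)) Filter.atTop Filter.atTop :=
    (tendsto_rpow_atTop (by norm_num)).comp tendsto_natCast_atTop_atTop
  have hlog2 : 0 < Real.log 2 := Real.log_pos (by norm_num)
  have hlog : ∀ᶠ u : ℝ in Filter.atTop, Real.log u ≤ Real.log 2 / 4 * u := by
    have := Real.isLittleO_log_id_atTop.bound (show 0 < Real.log 2 / 4 by positivity)
    filter_upwards [this, Filter.eventually_ge_atTop 0] with u h hu0
    simpa [abs_of_nonneg hu0] using (le_abs_self _).trans h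
  have hev : ∀ᶠ u : ℝ in Filter.atTop, C ≤ u ∧ 6 ≤ u ∧ Real.log u ≤ Real.log 2 / 4 * u := by
    filter_upwards [Filter.eventually_ge_atTop C, Filter.eventually_ge_atTop 6, hlog]
      with u h1 h2 h3 using ⟨h1, h2, h3⟩
  obtain ⟨m₀, hm₀⟩ := Filter.eventually_atTop.1
    ((hu.eventually hev).and (Filter.eventually_ge_atTop 1))
  refine ⟨m₀, fun m hm => ?_⟩
  obtain ⟨⟨hC, h6, hle⟩, hm1⟩ := hm₀ m hm
  set u := (m : ℝ) ^ (1 / 3 : ℝ) with hu_def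
  have hm0 : (0 : ℝ) < m := by exact_mod_cast hm1
  have hu0 : 0 < u := by linarith
  have hlogm : Real.log m = 3 * Real.log u := by
    rw [hu_def, Real.log_rpow hm0]
    ring
  set y := 2 / 3 * Real.logb 2 m + 1 with hy
  have hy' : y = 2 * Real.logb 2 u + 1 := by
    rw [hy, Real.logb, Real.logb, hlogm]
    ring
  have hlogb1 : 1 ≤ Real.logb 2 u := by
    rw [Real.le_logb_iff_rpow_le (by norm_num) hu0]
    norm_num
    linarith
  have hlogb2 : Real.logb 2 u ≤ u / 4 := by
    rw [Real.logb, div_le_iff₀ hlog2]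
    linarith
  have hy0 : 0 < y := by linarith
  have hfl : 1 ≤ ⌊Real.logb 2 y⌋₊ := by
    refine Nat.le_floor ?_
    rw [Real.le_logb_iff_rpow_le (by norm_num) hy0]
    norm_num
    linarith
  have hpow : (2 : ℝ) ^ ⌊Real.logb 2 y⌋₊ ≤ y := by
    rw [← Real.rpow_natCast, ← Real.le_logb_iff_rpow_le (by norm_num) hy0]
    exact Nat.floor_le (Real.logb_nonneg (by norm_num) (by linarith))
  have hkS : kStar m = ⌊Real.logb 2 y⌋₊ + 2 := rfl
  obtain ⟨L, hL⟩ := Nat.exists_eq_add_of_le' hfl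
  rw [hL] at hkS hpow
  refine ⟨hm1, hC, ?_, L, hkS, ?_⟩
  · have : ((L + 1 : ℕ) : ℝ) < 2 ^ (L + 1) := by exact_mod_cast Nat.lt_two_pow_self
    rw [hkS]
    push_cast at this ⊢
    linarith
  · rw [gam_succ_eq]
    have h1 : (2 : ℝ) ^ ((2 ^ (L + 1) : ℕ) : ℝ) ≤ 2 ^ y :=
      Real.rpow_le_rpow_of_exponent_le (by norm_num) (by exact_mod_cast hpow)
    have h2 : (2 : ℝ) ^ y = 2 * u ^ 2 := by
      rw [hy', Real.rpow_add (by norm_num), Real.rpow_one, mul_comm 2 (Real.logb 2 u),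
        Real.rpow_mul (by norm_num), Real.rpow_logb (by norm_num) (by norm_num) hu0]
      norm_cast
      ring
    rw [h2, Real.rpow_natCast] at h1
    rw [one_div_pow, mul_one_div, div_le_div_iff₀ (by positivity) (by positivity)]
    linarith

/-! ### All stages together -/

theorem bigT_pos {n : ℕ} (m : ℕ) {e : Fin n → ℝ} (he : ∃ j, 0 < e j) : 0 < bigT m e := by
  obtain ⟨j, hj⟩ := he
  have := hj.trans_le ((le_ciSup (Set.finite_range e).bddAbove j).trans
    (le_max_right ((1 / (m : ℝ)) * ∑ j, e j) _))
  simp only [bigT]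
  linarith

theorem sum_le_bigT_mul {n m : ℕ} (hm : 1 ≤ m) (e : Fin n → ℝ) :
    ∑ j, e j ≤ 1 / 2 * (bigT m e * m) := by
  have hm0 : (0 : ℝ) < m := by exact_mod_cast hm
  have := le_max_left ((1 / (m : ℝ)) * ∑ j, e j) (⨆ j, e j)
  rw [one_div, inv_mul_le_iff₀ hm0, ← one_div] at this
  simp only [bigT]
  linarith

/-- With high probability, all stages up to `kStar m` are good at the same time. -/
theorem exists_forall_le_measureReal {α : ℝ} (hα : 32 < α) :
    ∃ m₀ : ℕ, ∀ m : ℕ, m₀ ≤ m → ∀ (n : ℕ) (δ : ℝ) (Ω : Type*) [MeasurableSpace Ω] (μ : Measure Ω)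
      [IsProbabilityMeasure μ] (P : Fin n → Ω → ℝ), (∀ j, Measurable (P j)) →
      (∀ j ω, 0 ≤ P j ω) → (∀ j, Integrable (P j) μ) → iIndepFun P μ →
      (∃ j, 0 < ∫ ω, P j ω ∂μ) → ∀ (e : Fin n → ℝ), (∀ j, e j = ∫ ω, P j ω ∂μ) →
      1 - eps α m ≤ μ.real {ω | ∀ k ≤ kStar m,
        remLoad m e δ α (fun j => P j ω) k ≤ gam k ∧
          3 / 4 ≤ availFrac m e δ α (fun j => P j ω) k} := by
  -- In these terms ε = exp(-(C - 1)u); the added 1 pays for the union bound, through k* ≤ e^u.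
  set C := (α - 32) ^ 2 / 768 + 1 with hC
  have hC1 : 1 ≤ C := by
    rw [hC]
    have : 0 ≤ (α - 32) ^ 2 / 768 := by positivity
    linarith
  obtain ⟨m₀, hm₀⟩ := kStar_eventually (24 * C)
  refine ⟨m₀, fun m hm n δ Ω _ μ _ P hP hP0 hint hind hex e he => ?_⟩
  obtain ⟨hm1, huC, hKu, L, hKL, hgam⟩ := hm₀ m hm
  have hmpos : (0 : ℝ) < m := by exact_mod_cast hm1
  have hu3 : ((m : ℝ) ^ (1 / 3 : ℝ)) ^ 3 = m := by
    rw [← Real.rpow_natCast, ← Real.rpow_mul hmpos.le]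
    norm_num
  have heps : eps α m = Real.exp (-((C - 1) * (m : ℝ) ^ (1 / 3 : ℝ))) := by
    rw [eps, hC]
    ring_nf
  set u := (m : ℝ) ^ (1 / 3 : ℝ) with hu
  have hu0 : 0 < u := by linarith
  have he0 : ∀ j, 0 ≤ e j := fun j => he j ▸ integral_nonneg (hP0 j)
  have hT : 0 < bigT m e := bigT_pos m (by simpa only [he] using hex)
  have hα0 : 0 < α := by linarith
  have hαT : 0 < α * bigT m e := by positivity
  -- Chosen so that mζ = 2Cu, making each stage fail with probability at most exp(-Cu).
  set ζ := 2 * C / u ^ 2 with hζ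
  have hζ0 : 0 ≤ ζ := by positivity
  have hmζ : m * ζ = 2 * (C * u) := by
    rw [hζ, ← hu3]
    field_simp
  have hu2 : 24 * C * u ≤ u ^ 2 := by nlinarith
  set bad : ℕ → Set Ω := fun k => {ω | (state m e δ α (fun j => P j ω) k).2.Nonempty ∧
      max (4 * (∑ j ∈ (state m e δ α (fun j => P j ω) k).1, e j) / (α * bigT m e)) (m * ζ) ≤
        numLate e (α * bigT m e) (state m e δ α (fun j => P j ω) k).1
          (state m e δ α (fun j => P j ω) k).2 (fun j => P j ω)} with hbad
  have hbadle : μ.real (⋃ k ∈ Finset.range (kStar m), bad k) ≤ eps α m := by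
    refine (measureReal_biUnion_finset_le _ _).trans ?_
    calc ∑ k ∈ Finset.range (kStar m), μ.real (bad k)
        ≤ ∑ k ∈ Finset.range (kStar m), Real.exp (-(m * ζ) / 2) :=
          Finset.sum_le_sum fun k _ =>
            measureReal_exists_numLate_ge_le m hP hP0 hint hind he δ α hαT (m * ζ) k
      _ = kStar m * Real.exp (-(C * u)) := by
          rw [Finset.sum_const, Finset.card_range, nsmul_eq_mul, hmζ]
          ring_nf
      _ ≤ Real.exp u * Real.exp (-(C * u)) := by
          gcongr
          linarith [Real.add_one_le_exp u]
      _ = eps α m := by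
          rw [heps, ← Real.exp_add]
          ring_nf
  suffices hgood : (⋃ k ∈ Finset.range (kStar m), bad k) ∪ {ω | ∀ k ≤ kStar m,
        remLoad m e δ α (fun j => P j ω) k ≤ gam k ∧
          3 / 4 ≤ availFrac m e δ α (fun j => P j ω) k} = Set.univ by
    have h := measureReal_union_le (μ := μ) (⋃ k ∈ Finset.range (kStar m), bad k) {ω | ∀ k ≤ kStar m,
        remLoad m e δ α (fun j => P j ω) k ≤ gam k ∧
          3 / 4 ≤ availFrac m e δ α (fun j => P j ω) k}
    rw [hgood, probReal_univ] at h
    linarith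
  refine Set.eq_univ_of_forall fun ω => ?_
  rw [Set.mem_union, or_iff_not_imp_left]
  intro hω
  simp only [Set.mem_iUnion, Finset.mem_range, not_exists] at hω
  set p : Fin n → ℝ := fun j => P j ω with hp
  have hp0 : ∀ j, 0 ≤ p j := fun j => hP0 j ω
  have hx : ∀ h, 0 ≤ remLoad m e δ α p h := fun h =>
    div_nonneg (Finset.sum_nonneg fun j _ => he0 j) (by positivity)
  have hx0 : remLoad m e δ α p 0 ≤ 1 / 2 := by
    rw [remLoad, div_le_iff₀ (by positivity)]
    exact sum_le_bigT_mul hm1 e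
  have ha0 : availFrac m e δ α p 0 = 1 := by
    simp [availFrac, state, hmpos.ne']
  have hζK : (kStar m : ℝ) * ζ ≤ 1 / 12 := by
    calc (kStar m : ℝ) * ζ ≤ u * ζ := by gcongr
      _ = 2 * C / u := by
          rw [hζ]
          field_simp
      _ ≤ 1 / 12 := by
          rw [div_le_div_iff₀ hu0 (by norm_num)]
          linarith
  have hζ16 : ζ ≤ 1 / 16 := by
    rw [hζ, div_le_div_iff₀ (by positivity) (by norm_num)]
    nlinarith
  obtain ⟨ha, hrec⟩ := avail_ge_and_load_le hα hζ0 hζ16 hζK hx hx0 ha0 (by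
    intro h hh hah
    set Z := numLate e (α * bigT m e) (state m e δ α p h).1 (state m e δ α p h).2 p with hZ
    have hne : (state m e δ α p h).2.Nonempty := by
      rw [availFrac, div_pos_iff_of_pos_right hmpos, Nat.cast_pos] at hah
      exact Finset.card_pos.1 hah
    have hlt : (Z : ℝ) <
        max (4 * (∑ j ∈ (state m e δ α p h).1, e j) / (α * bigT m e)) (m * ζ) := by
      by_contra! hcon
      exact hω h hh ⟨hne, hcon⟩
    refine ⟨Z / m, by positivity, ?_, ?_, ?_⟩
    · rw [div_le_iff₀ hmpos, max_mul_of_nonneg _ _ hmpos.le, mul_comm ζ]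
      refine hlt.le.trans_eq ?_
      congr 1
      rw [remLoad]
      field_simp
    · rw [availFrac, availFrac, ← add_div]
      gcongr
      exact_mod_cast card_le_card_state_succ_add e δ α hp0 h
    · have := sum_state_succ_mul_card_le he0 δ hαT hp0 h hne
      rw [remLoad, remLoad, availFrac, div_mul_div_comm, ← mul_div_assoc 2, div_mul_div_comm]
      gcongr)
  -- Otherwise γ_{L+2} = γ_{L+1}²/2 would be smaller than u⁻².
  have hgam1 : 1 / u ≤ gam (L + 1) := by
    by_contra! hlt
    have hsq := pow_lt_pow_left₀ hlt (gam_pos _).le two_ne_zero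
    have hg : gam (L + 2) = gam (L + 1) ^ 2 / 2 := gam_succ (by omega)
    rw [one_div_pow] at hsq
    linarith [sq_nonneg (gam (L + 1))]
  have hload := load_le_gam (η := 4 * ζ) (L := L) (by positivity) (by linarith) ?_ ?_ hx hx0
    (by simpa only [← hKL] using hrec)
  · rw [← hKL] at hload
    exact fun k hk => ⟨hload k hk, ha k hk⟩
  · refine le_trans ?_ hgam1
    rw [hζ, le_div_iff₀ hu0]
    have : 2 * (4 * (2 * C / u ^ 2)) * u = 16 * C / u := by
      field_simp
      ring
    rw [this, div_le_one hu0]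
    linarith
  · refine le_trans ?_ hgam
    rw [hζ, le_div_iff₀ (by positivity)]
    have : 2 * (4 * (2 * C / u ^ 2)) ^ 2 * u ^ 2 = 128 * C ^ 2 / u ^ 2 := by
      field_simp
      ring
    rw [this, div_le_one (by positivity)]
    nlinarith

end LEPTDelay

end

open LEPTDelay in
theorem mainTheorem1 (α : ℝ) (hα : 32 < α) :
    ∃ m₀ : ℕ, ∀ m : ℕ, m₀ ≤ m →
      ∀ (n : ℕ) (δ : ℝ), 0 ≤ δ →
      ∀ (Ω : Type*) [MeasurableSpace Ω] (μ : MeasureTheory.Measure Ω)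
        [MeasureTheory.IsProbabilityMeasure μ] (P : Fin n → Ω → ℝ),
        (∀ j, Measurable (P j)) →
        (∀ j ω, 0 ≤ P j ω) →
        (∀ j, MeasureTheory.Integrable (P j) μ) →
        ProbabilityTheory.iIndepFun P μ →
        (∃ j, 0 < ∫ ω, P j ω ∂μ) →
      ∀ (e : Fin n → ℝ), (∀ j, e j = ∫ ω, P j ω ∂μ) →
      ∀ k : ℕ, 1 ≤ k → k < kStar m →
        1 - (2 ^ k - 1) * eps α m ≤
          μ.real {ω | remLoad m e δ α (fun j => P j ω) k ≤ gam k} →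
        1 - (2 ^ k - 1) * eps α m ≤
          μ.real {ω | bet α k - ((k : ℝ) - 2) * psi m ≤
            availFrac m e δ α (fun j => P j ω) k} →
        1 - (2 ^ (k + 1) - 1) * eps α m ≤
          μ.real {ω | remLoad m e δ α (fun j => P j ω) (k + 1) ≤ gam (k + 1)} ∧
        1 - (2 ^ (k + 1) - 1) * eps α m ≤
          μ.real {ω | bet α (k + 1) - (((k + 1 : ℕ) : ℝ) - 2) * psi m ≤
            availFrac m e δ α (fun j => P j ω) (k + 1)} := by
  obtain ⟨m₀, hm₀⟩ := exists_forall_le_measureReal hα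
  refine ⟨m₀, fun m hm n δ _ Ω _ μ _ P hP hP0 hint hind hex e he k hk1 hk _ _ => ?_⟩
  have hmain := hm₀ m hm n δ Ω μ P hP hP0 hint hind hex e he
  have hεpos : 0 < eps α m := Real.exp_pos _
  have hpow : (2 : ℝ) ≤ 2 ^ (k + 1) := by
    rw [pow_succ]
    linarith [one_le_pow₀ (one_le_two (α := ℝ)) (n := k)]
  have hle : 1 - (2 ^ (k + 1) - 1) * eps α m ≤ 1 - eps α m := by nlinarith
  -- The coefficient of ψ is k - 1, nonnegative since k ≥ 1, so the threshold never exceeds 3/4.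
  have hbet : bet α (k + 1) - (((k + 1 : ℕ) : ℝ) - 2) * psi m ≤ 3 / 4 := by
    have h1 : 0 ≤ 2 / α * ∑ h ∈ Finset.Icc 1 (k + 1 - 2), gam h :=
      mul_nonneg (by positivity) (Finset.sum_nonneg fun h _ => (gam_pos h).le)
    have h2 : 0 ≤ (((k + 1 : ℕ) : ℝ) - 2) * psi m := by
      have : (1 : ℝ) ≤ k := by exact_mod_cast hk1
      refine mul_nonneg (by push_cast; linarith) ?_
      rw [psi]
      positivity
    rw [bet]
    linarith
  constructor
  · exact hle.trans (hmain.trans (MeasureTheory.measureReal_mono (fun ω hω => (hω (k + 1) hk).1)))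
  · exact hle.trans (hmain.trans (MeasureTheory.measureReal_mono
      (fun ω hω => hbet.trans (hω (k + 1) hk).2)))
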